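/- Let $d\ge 0$, let $\mathbb{R}^d$ carry the Euclidean norm, and let $\mathcal S\subset\mathbb{R}^d$ be a bounded closed set which is a proximal retract, i.e. the nearest-point projection onto $\mathcal S$ is single valued on some neighbourhood of $\mathcal S$. For $x\in\mathcal S$ let $$T_{\mathcal S}(x)=\{v:\liminf_{h\to0^+} d(x+hv,\mathcal S)/h=0\},\qquad N_{\mathcal S}(x)=\{p:\langle p,v\rangle\le 0\ \ \forall v\in T_{\mathcal S}(x)\}.$$ On a probability space, let $(x_k)_{k\ge0}$ satisfy $$x_{k+1}=(1-\gamma_k)x_k+\gamma_k f(x_k)+a_k\big(H(x_k)+M_{k+1}\big),\qquad k\ge 0,$$ and assume the following. 1. $H:\mathbb{R}^d\to\mathbb{R}^d$ is Lipschitz. 2. $a_k,\gamma_k>0$, $\sum_k a_k=\sum_k\gamma_k=\infty$, $\sum_k a_k^2<\infty$, $\sum_k\gamma_k^2<\infty$, and $a_k=o(\gamma_k)$. 3. $(M_n)_{n\ge1}$ is a square integrable martingale difference sequence with respect to $\mathcal F_n=\sigma(x_0,M_1,\dots,M_n)$, i.e. $\mathbb{E}[M_{n+1}\mid\mathcal F_n]=0$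 a.s., and $\sup_n\mathbb{E}[\|M_{n+1}\|^2\mid\mathcal F_n]<\infty$ a.s. 4. Almost surely, the iterates $x_k$ remain in a (possibly sample point dependent) compact set. 5. $f:\mathbb{R}^d\to\mathbb{R}^d$ is non-expansive, $\|f(x)-f(y)\|\le\|x-y\|$ for all $x,y$, and its $n$-fold iterates $f^n$ converge, uniformly on compact sets, to a map $P$ which is a Euclidean projection onto $\mathcal S$: for all $y$, $P(y)\in\mathcal S$ minimizes $\|y-z\|$ over $z\in\mathcal S$. 6. Let $\Lambda=\{x\in\mathcal S: H(x)\in N_{\mathcal S}(x)\}$. There is a continuously differentiable $V:\mathbb{R}^d\to\mathbb{R}$, with $V(\Lambda)$ having empty interior in $\mathbb{R}$, such that every locally absolutely continuous solution $x:[0,\infty)\to\mathcal S$ of the differential inclusion $\dot x(t)\in H(x(t))-N_{\mathcal S}(x(t))$ (for a.e. $t$) satisfies $V(x(t))\le V(x(0))$ for all $t>0$, with strict inequality for all $t>0$ if $x(0)\notin\Lambda$. 7. For some $T>0$, with $m(n)=\min\{k\ge n:\sum_{j=n}^{k}a_j\ge T\}$, $$\lim_{n\to\infty}\sum_{j=n}^{m(n)}\gamma_j\|f(x_j)-x_j\|=0\quad\text{a.s.}$$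 Then $x_n$ converges almost surely to $\Lambda$, i.e. $d(x_n,\Lambda)\to0$ a.s. (in particular $\Lambda\neq\emptyset$). -/

import Mathlib

open Filter Topology MeasureTheory

noncomputable section

/-- Step sizes: positive, with divergent sum and summable squares. -/
structure IsStepSize (a : ℕ → ℝ) : Prop where
  pos : ∀ n, 0 < a n
  sum_eq_top : Tendsto (fun n => ∑ i ∈ Finset.range n, a i) atTop atTop
  sq_summable : Summable fun n => a n ^ 2

/-- The `σ`-field `σ(x₀, M₁, …, Mₙ)`. -/
@[reducible]
def noiseSigma {Ω : Type*} {d : ℕ} (x₀ : Ω → EuclideanSpace ℝ (Fin d))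
    (M : ℕ → Ω → EuclideanSpace ℝ (Fin d)) (n : ℕ) : MeasurableSpace Ω :=
  MeasurableSpace.comap x₀ inferInstance ⊔
    ⨆ m ∈ Finset.Icc 1 n, MeasurableSpace.comap (M m) inferInstance

/-- `M₁, M₂, …` is a square integrable martingale difference sequence with respect to
`σ(x₀, M₁, …, Mₙ)`, and its conditional second moments are almost surely bounded in `n`
(the bound may depend on the sample point). The value `M 0` plays no role. -/
structure IsMartingaleNoise {Ω : Type*} [MeasurableSpace Ω] {d : ℕ} (μ : Measure Ω)
    (x₀ : Ω → EuclideanSpace ℝ (Fin d)) (M : ℕ → Ω → EuclideanSpace ℝ (Fin d)) : Prop where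
  measurable_init : Measurable x₀
  measurable_noise : ∀ n, Measurable (M (n + 1))
  memLp_two : ∀ n, MemLp (M (n + 1)) 2 μ
  condExp_eq_zero : ∀ n, μ[M (n + 1) | noiseSigma x₀ M n] =ᵐ[μ] 0
  condExp_sq_bdd : ∀ᵐ ω ∂μ, BddAbove (Set.range fun n =>
    (μ[fun ω' => ‖M (n + 1) ω'‖ ^ 2 | noiseSigma x₀ M n]) ω)

/-- The set of Euclidean projections (nearest points) of `y` on `S`. -/
def projSet {d : ℕ} (S : Set (EuclideanSpace ℝ (Fin d))) (y : EuclideanSpace ℝ (Fin d)) :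
    Set (EuclideanSpace ℝ (Fin d)) :=
  {p | p ∈ S ∧ ∀ z ∈ S, ‖y - p‖ ≤ ‖y - z‖}

/-- A proximal retract: a closed set with a neighbourhood on which the projection is
single valued. -/
def IsProximalRetract {d : ℕ} (S : Set (EuclideanSpace ℝ (Fin d))) : Prop :=
  IsClosed S ∧ ∃ N ∈ 𝓝ˢ S, ∀ y ∈ N, ∃! p, p ∈ projSet S y

/-- The map `f` is continuous and its iterates converge, uniformly on compact sets, to a
Euclidean projection `P` onto `S`. -/
structure IsApproxProjection {d : ℕ} (S : Set (EuclideanSpace ℝ (Fin d)))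
    (f P : EuclideanSpace ℝ (Fin d) → EuclideanSpace ℝ (Fin d)) : Prop where
  continuous : Continuous f
  tendsto_iterate : ∀ K : Set (EuclideanSpace ℝ (Fin d)), IsCompact K →
    TendstoUniformlyOn (fun (n : ℕ) x => f^[n] x) P atTop K
  proj : ∀ y, P y ∈ projSet S y

/-- The contingent (tangent) cone of `S` at a point `x ∈ S`. -/
def contingentCone {d : ℕ} (S : Set (EuclideanSpace ℝ (Fin d)))
    (x : EuclideanSpace ℝ (Fin d)) : Set (EuclideanSpace ℝ (Fin d)) :=
  {v | liminf (fun h : ℝ => Metric.infDist (x + h • v) S / h) (𝓝[>] 0) = 0}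

/-- The normal cone of `S` at a point `x ∈ S`: the polar of the contingent cone. -/
def normalCone {d : ℕ} (S : Set (EuclideanSpace ℝ (Fin d)))
    (x : EuclideanSpace ℝ (Fin d)) : Set (EuclideanSpace ℝ (Fin d)) :=
  {p | ∀ v ∈ contingentCone S x, inner ℝ p v ≤ 0}

/-- The set `Λ` of equilibria of the projected differential inclusion. -/
def equilibriumSet {d : ℕ} (S : Set (EuclideanSpace ℝ (Fin d)))
    (H : EuclideanSpace ℝ (Fin d) → EuclideanSpace ℝ (Fin d)) :
    Set (EuclideanSpace ℝ (Fin d)) :=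
  {x | x ∈ S ∧ H x ∈ normalCone S x}

/-- `y` is a solution on `[0, ∞)` of the projected differential inclusion
`y' ∈ H y - N_S y`, `y ∈ S`: it is locally absolutely continuous, stays in `S`, and
satisfies the inclusion at almost every time. -/
structure IsInclusionSolution {d : ℕ} (S : Set (EuclideanSpace ℝ (Fin d)))
    (H : EuclideanSpace ℝ (Fin d) → EuclideanSpace ℝ (Fin d))
    (y : ℝ → EuclideanSpace ℝ (Fin d)) : Prop where
  absolutelyContinuous : ∀ T : ℝ, 0 < T → AbsolutelyContinuousOnInterval y 0 T
  mem : ∀ t : ℝ, 0 ≤ t → y t ∈ S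
  inclusion : ∀ᵐ t : ℝ, 0 < t →
    ∃ p ∈ normalCone S (y t), HasDerivAt y (H (y t) - p) t

/-- `V` is a continuously differentiable Lyapunov function for the equilibrium set `Λ` of the
projected differential inclusion, and `V(Λ)` has empty interior. -/
structure IsLyapunovFunction {d : ℕ} (S : Set (EuclideanSpace ℝ (Fin d)))
    (H : EuclideanSpace ℝ (Fin d) → EuclideanSpace ℝ (Fin d))
    (V : EuclideanSpace ℝ (Fin d) → ℝ) : Prop where
  contDiff : ContDiff ℝ 1 V
  le : ∀ y : ℝ → EuclideanSpace ℝ (Fin d), IsInclusionSolution S H y →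
    ∀ t : ℝ, 0 < t → V (y t) ≤ V (y 0)
  lt : ∀ y : ℝ → EuclideanSpace ℝ (Fin d), IsInclusionSolution S H y →
    y 0 ∉ equilibriumSet S H → ∀ t : ℝ, 0 < t → V (y t) < V (y 0)
  interior_image : interior (V '' equilibriumSet S H) = ∅

/-- `windowEnd a T n = min {k ≥ n : a n + ⋯ + a k ≥ T}`. The set is non-empty as soon as
`∑ a = ∞`. -/
def windowEnd (a : ℕ → ℝ) (T : ℝ) (n : ℕ) : ℕ :=
  sInf {k | n ≤ k ∧ T ≤ ∑ j ∈ Finset.Icc n k, a j}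

end

/-! Since `f` is non-expansive, so is the limit `P` of its iterates; hence `G = H ∘ P` is globally
Lipschitz, and bounded because `P` takes values in the bounded set `S`. The iteration is an Euler
scheme for `y' = G y` with three perturbations: `γ_k (f x_k - x_k)`, `a_k M_{k+1}` and `a_k (H x_k -
H (P x_k))`. Over windows of bounded `a`-length they sum to nearly zero: the first by the window
hypothesis, the second by martingale convergence, the third because the distance from `x_k` to `S`
tends to zero. That distance vanishes because `a = o(γ)` lets `‖f x - x‖` stay away from zero only
for a short `a`-time, fixed points of `f` lie in `S`, and the scheme moves little in a short time
(`tendsto_infDist_of_window`).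

By Gronwall the scheme shadows solutions of `y' = G y`, so its limit set is forward invariant
(`mapClusterPt_solution`). The limit set lies in `S`, where `P` is the identity. Solutions starting
in it therefore stay in `S` and satisfy `y' = H y`, which is the inclusion with normal vector `0`,
so `V` decreases along them.

If some cluster point were outside `Λ`, `V (x_k)` would cross infinitely often upwards from a level
outside `V '' Λ`. A limit of the starting points of these crossings would carry a solution along
which `V` does not decrease, a contradiction (`tendsto_infEDist_of_lyapunov`). -/

open scoped NNReal in
/-- A bounded Lipschitz vector field has global integral curves through every point. -/
theorem exists_global_solution {E : Type*} [NormedAddCommGroup E] [NormedSpace ℝ E]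
    [CompleteSpace E] {G : E → E} {L B : ℝ≥0} (hL : LipschitzWith L G) (hB : ∀ u, ‖G u‖ ≤ B)
    (q : E) : ∃ y : ℝ → E, y 0 = q ∧ ∀ t, HasDerivAt y (G (y t)) t := by
  have hloc : ∀ n : ℕ, ∃ α : ℝ → E, α 0 = q ∧
      ∀ t ∈ Set.Ioo (-(n + 1 : ℝ)) (n + 1), HasDerivAt α (G (α t)) t := by
    intro n
    have h0 : (0 : ℝ) ∈ Set.Icc (-(n + 1 : ℝ)) (n + 1) := ⟨by linarith [n.cast_nonneg (α := ℝ)],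
      by linarith [n.cast_nonneg (α := ℝ)]⟩
    -- As the bound `B` holds everywhere, a ball of radius `B * (n + 1)` cannot be left by time `n +
    -- 1`, so the interval may be arbitrarily long.
    have hp : IsPicardLindelof (fun _ ↦ G) (⟨0, h0⟩ : Set.Icc (-(n + 1 : ℝ)) (n + 1)) q
        (B * (n + 1)) 0 B L :=
      IsPicardLindelof.of_time_independent (fun x _ ↦ hB x) hL.lipschitzOnWith (by simp)
    obtain ⟨α, h1, h2⟩ := hp.exists_eq_forall_mem_Icc_hasDerivWithinAt₀
    exact ⟨α, h1, fun t ht ↦ (h2 t (Set.Ioo_subset_Icc_self ht)).hasDerivAt (Icc_mem_nhds ht.1 ht.2)⟩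
  choose α h0 hα using hloc
  have key : ∀ n m : ℕ, n ≤ m → ∀ s : ℝ, |s| < n + 1 → α n s = α m s := by
    intro n m hnm s hs
    have hnm' : (n : ℝ) ≤ m := by exact_mod_cast hnm
    have hn : (0 : ℝ) ≤ n := n.cast_nonneg
    refine ODE_solution_unique_of_mem_Ioo (v := fun _ ↦ G) (s := fun _ ↦ Set.univ) (t₀ := 0)
      (fun t _ ↦ hL.lipschitzOnWith) ⟨by linarith, by linarith⟩
      (fun t ht ↦ ⟨hα n t ht, trivial⟩)
      (fun t ht ↦ ⟨hα m t ⟨by linarith [ht.1], by linarith [ht.2]⟩, trivial⟩)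
      ((h0 n).trans (h0 m).symm) (abs_lt.1 hs)
  have key' : ∀ n m : ℕ, ∀ s : ℝ, |s| < n + 1 → |s| < m + 1 → α n s = α m s := by
    intro n m s hn hm
    rcases le_total n m with h | h
    · exact key n m h s hn
    · exact (key m n h s hm).symm
  have hceil : ∀ s : ℝ, |s| < (⌈|s|⌉₊ : ℝ) + 1 := fun s ↦ by linarith [Nat.le_ceil |s|]
  refine ⟨fun t ↦ α ⌈|t|⌉₊ t, h0 _, fun t ↦ ?_⟩
  have hev : (fun s ↦ α ⌈|s|⌉₊ s) =ᶠ[𝓝 t] α ⌈|t|⌉₊ := by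
    filter_upwards [continuous_abs.continuousAt.eventually (gt_mem_nhds (hceil t))] with s hs
    exact key' _ _ _ (hceil s) hs
  exact (hα _ t (abs_lt.1 (hceil t))).congr_of_eventuallyEq hev

/-! ### Perturbed Euler schemes and shadowing of solutions. -/

section Shadowing

variable {E : Type*} [NormedAddCommGroup E]

/-- The sums of `ξ` over windows of `a`-length at most `T` tend to zero. -/
def IsNegligible (a : ℕ → ℝ) (T : ℝ) (ξ : ℕ → E) : Prop :=
  ∀ ε > 0, ∃ N, ∀ n ≥ N, ∀ k ≥ n, ∑ i ∈ Finset.Ico n k, a i ≤ T →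
    ‖∑ i ∈ Finset.Ico n k, ξ i‖ ≤ ε

variable [NormedSpace ℝ E]

open scoped NNReal in
theorem lipschitzWith_solution {G : E → E} {B : ℝ≥0} (hB : ∀ u, ‖G u‖ ≤ B) {y : ℝ → E}
    (hy : ∀ t, HasDerivAt y (G (y t)) t) : LipschitzWith B y :=
  lipschitzWith_of_nnnorm_deriv_le (fun t ↦ (hy t).differentiableAt) fun t ↦ by
    rw [(hy t).deriv]; exact_mod_cast hB (y t)

open scoped NNReal in
/-- The error of one explicit Euler step is quadratic. -/
theorem norm_euler_error_le {G : E → E} {L B : ℝ≥0} (hL : LipschitzWith L G)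
    (hB : ∀ u, ‖G u‖ ≤ B) {y : ℝ → E} (hy : ∀ t, HasDerivAt y (G (y t)) t) (s : ℝ) {h : ℝ}
    (hh : 0 ≤ h) : ‖y (s + h) - y s - h • G (y s)‖ ≤ L * B * h * h := by
  have hd : ∀ z : ℝ, HasDerivAt (fun z ↦ y (s + z) - z • G (y s)) (G (y (s + z)) - G (y s)) z := by
    intro z
    have h1 : HasDerivAt (fun z ↦ y (s + z)) (G (y (s + z))) z :=
      (hy (s + z)).comp_const_add s z
    have h2 : HasDerivAt (fun z : ℝ ↦ z • G (y s)) (G (y s)) z := by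
      simpa using (hasDerivAt_id z).smul_const (G (y s))
    exact h1.sub h2
  have hbd : ∀ z ∈ Set.Icc 0 h, ‖G (y (s + z)) - G (y s)‖ ≤ L * B * h := by
    intro z hz
    have h1 := hL.norm_sub_le (y (s + z)) (y s)
    have h2 := (lipschitzWith_solution hB hy).norm_sub_le (s + z) s
    rw [add_sub_cancel_left, Real.norm_of_nonneg hz.1] at h2
    have : (B : ℝ) * z ≤ B * h := mul_le_mul_of_nonneg_left hz.2 B.2
    calc _ ≤ _ := h1
      _ ≤ L * (B * h) := by gcongr; linarith
      _ = _ := by ring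
  have := (convex_Icc (0 : ℝ) h).norm_image_sub_le_of_norm_hasDerivWithin_le
    (fun z _ ↦ (hd z).hasDerivWithinAt) hbd (Set.left_mem_Icc.2 hh) (Set.right_mem_Icc.2 hh)
  simp only [add_zero, zero_smul, sub_zero, Real.norm_of_nonneg hh] at this
  rwa [sub_right_comm]

open scoped NNReal in
/-- A perturbed Euler scheme stays close to the solution it starts close to. -/
theorem eventually_norm_sub_solution_le {G : E → E} {L B : ℝ≥0} (hL : LipschitzWith L G)
    (hB : ∀ u, ‖G u‖ ≤ B) {a : ℕ → ℝ} (ha : ∀ n, 0 < a n) (ha0 : Tendsto a atTop (𝓝 0))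
    {T : ℝ} (hT : 0 ≤ T) {x ξ : ℕ → E} (hx : ∀ k, x (k + 1) = x k + a k • G (x k) + ξ k)
    (hξ : IsNegligible a T ξ) {y : ℝ → E} (hy : ∀ t, HasDerivAt y (G (y t)) t)
    {φ : ℕ → ℕ} (hφ : Tendsto φ atTop atTop) (hxφ : Tendsto (x ∘ φ) atTop (𝓝 (y 0)))
    {ε : ℝ} (hε : 0 < ε) :
    ∀ᶠ j in atTop, ∀ k ≥ φ j, ∑ i ∈ Finset.Ico (φ j) k, a i ≤ T →
      ‖x k - y (∑ i ∈ Finset.Ico (φ j) k, a i)‖ ≤ ε := by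
  set C : ℝ := (1 + T * L + L * B * T) * Real.exp (L * T) + 1 with hC
  have hC1 : 0 < C := by positivity
  set δ := ε / C with hδ
  have hδ0 : 0 < δ := by positivity
  obtain ⟨N, hN⟩ := hξ δ hδ0
  have haδ : ∀ᶠ n in atTop, ∀ k ≥ n, a k ≤ δ := by
    have := (ha0.eventually (gt_mem_nhds hδ0))
    obtain ⟨N, hN⟩ := eventually_atTop.1 this
    exact eventually_atTop.2 ⟨N, fun n hn k hk ↦ (hN k (hn.trans hk)).le⟩
  have hclose : ∀ᶠ j in atTop, ‖x (φ j) - y 0‖ ≤ δ := by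
    filter_upwards [hxφ (Metric.closedBall_mem_nhds _ hδ0)] with j hj
    simpa [dist_eq_norm] using hj
  filter_upwards [hclose, hφ.eventually haδ, hφ.eventually (eventually_ge_atTop N)]
    with j h1 h2 h3 k hk hkT
  set n := φ j
  set τ : ℕ → ℝ := fun k ↦ ∑ i ∈ Finset.Ico n k, a i with hτ
  set Ξ : ℕ → E := fun k ↦ ∑ i ∈ Finset.Ico n k, ξ i with hΞ
  -- Subtracting the accumulated perturbation makes `ξ` enter only through its window sums `Ξ`,
  -- which are small; the single norms `‖ξ i‖` need not be summable.
  set w : ℕ → E := fun k ↦ x k - y (τ k) - Ξ k with hw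
  have hstep : ∀ i ≥ n, ‖w (i + 1)‖ ≤ (1 + a i * L) * ‖w i‖ +
      (a i * L * ‖Ξ i‖ + L * B * a i * a i) := by
    intro i hi
    have e1 : τ (i + 1) = τ i + a i := Finset.sum_Ico_succ_top hi _
    have e2 : Ξ (i + 1) = Ξ i + ξ i := Finset.sum_Ico_succ_top hi _
    have e3 : w (i + 1) = w i + a i • (G (x i) - G (y (τ i))) -
        (y (τ i + a i) - y (τ i) - a i • G (y (τ i))) := by
      simp only [hw, e1, e2, hx, smul_sub]; abel
    have e4 := norm_euler_error_le hL hB hy (τ i) (ha i).le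
    have e5 : ‖G (x i) - G (y (τ i))‖ ≤ L * (‖w i‖ + ‖Ξ i‖) := by
      refine (hL.norm_sub_le _ _).trans ?_
      gcongr
      have : x i - y (τ i) = w i + Ξ i := by simp [hw]
      rw [this]; exact norm_add_le _ _
    calc ‖w (i + 1)‖ ≤ ‖w i‖ + ‖a i • (G (x i) - G (y (τ i)))‖ +
          ‖y (τ i + a i) - y (τ i) - a i • G (y (τ i))‖ := by
            rw [e3]; exact (norm_sub_le _ _).trans (by gcongr; exact norm_add_le _ _)
      _ ≤ ‖w i‖ + a i * (L * (‖w i‖ + ‖Ξ i‖)) + L * B * a i * a i := by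
            rw [norm_smul, Real.norm_of_nonneg (ha i).le]
            have := (ha i).le
            gcongr
      _ = _ := by ring
  have hg := discrete_gronwall (n₀ := n) (u := fun i ↦ ‖w i‖) (norm_nonneg _) hstep
    (fun i _ ↦ mul_nonneg (ha i).le L.2)
    (fun i _ ↦ by have := (ha i).le; positivity) hk
  have hτle : ∀ i ∈ Finset.Ico n k, τ i ≤ T := by
    intro i hi
    refine le_trans ?_ hkT
    exact Finset.sum_le_sum_of_subset_of_nonneg
      (Finset.Ico_subset_Ico_right (Finset.mem_Ico.1 hi).2.le) fun _ _ _ ↦ (ha _).le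
  have hwn : ‖w n‖ ≤ δ := by simpa [hw, hτ, hΞ] using h1
  have hb : ∑ i ∈ Finset.Ico n k, (a i * L * ‖Ξ i‖ + L * B * a i * a i) ≤
      (T * L + L * B * T) * δ := by
    calc _ ≤ ∑ i ∈ Finset.Ico n k, a i * ((L + L * B) * δ) := by
          refine Finset.sum_le_sum fun i hi ↦ ?_
          have hi' := (Finset.mem_Ico.1 hi).1
          have := hN n h3 i hi' (hτle i hi)
          have := h2 i hi'
          have := (ha i).le
          calc _ ≤ a i * L * δ + L * B * a i * δ := by gcongr
            _ = _ := by ring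
      _ = (∑ i ∈ Finset.Ico n k, a i) * ((L + L * B) * δ) := by rw [Finset.sum_mul]
      _ ≤ T * ((L + L * B) * δ) := by gcongr
      _ = _ := by ring
  have hc : ∑ i ∈ Finset.Ico n k, a i * (L : ℝ) ≤ L * T := by
    rw [← Finset.sum_mul, mul_comm]; gcongr
  have hwk : ‖w k‖ ≤ (δ + (T * L + L * B * T) * δ) * Real.exp (L * T) := by
    refine hg.trans ?_
    gcongr
  have hΞk := hN n h3 k hk hkT
  have : x k - y (τ k) = w k + Ξ k := by simp [hw]
  calc ‖x k - y (τ k)‖ ≤ ‖w k‖ + ‖Ξ k‖ := by rw [this]; exact norm_add_le _ _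
    _ ≤ (δ + (T * L + L * B * T) * δ) * Real.exp (L * T) + δ := add_le_add hwk hΞk
    _ = δ * C := by rw [hC]; ring
    _ = ε := div_mul_cancel₀ _ hC1.ne'

/-- Positive steps with divergent sum reach every time `s` from every index, up to one step. -/
theorem exists_sum_Ico_le_lt {a : ℕ → ℝ}
    (hsum : Tendsto (fun n => ∑ i ∈ Finset.range n, a i) atTop atTop) (n : ℕ) {s : ℝ}
    (hs : 0 ≤ s) : ∃ k ≥ n, ∑ i ∈ Finset.Ico n k, a i ≤ s ∧
      s < ∑ i ∈ Finset.Ico n (k + 1), a i := by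
  classical
  have hex : ∃ k, n ≤ k ∧ s < ∑ i ∈ Finset.Ico n k, a i := by
    obtain ⟨k, hk, hk'⟩ := ((hsum.eventually_gt_atTop (s + ∑ i ∈ Finset.range n, a i)).and
      (eventually_ge_atTop n)).exists
    refine ⟨k, hk', ?_⟩
    rw [Finset.sum_Ico_eq_sub _ hk']; linarith
  obtain ⟨h1, h2⟩ := Nat.find_spec hex
  set m := Nat.find hex with hm
  have hnm : n ≠ m := by
    rintro h
    rw [← h] at h2
    simp at h2; linarith
  obtain ⟨k, hk⟩ : ∃ k, m = k + 1 := ⟨m - 1, by omega⟩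
  have hmin := Nat.find_min hex (m := k) (by omega)
  refine ⟨k, by omega, ?_, hk ▸ h2⟩
  by_contra hlt
  exact hmin ⟨by omega, not_le.1 hlt⟩

-- Take for `κ j` the last index reached by `a`-time `s` after `φ j`. It misses `s` by less than one
-- step, which tends to zero, so shadowing and continuity of `y` give the limit.
open scoped NNReal in
theorem exists_index_tendsto_solution {G : E → E} {L B : ℝ≥0} (hL : LipschitzWith L G)
    (hB : ∀ u, ‖G u‖ ≤ B) {a : ℕ → ℝ} (ha : ∀ n, 0 < a n) (ha0 : Tendsto a atTop (𝓝 0))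
    (hsum : Tendsto (fun n => ∑ i ∈ Finset.range n, a i) atTop atTop)
    {T : ℝ} {x ξ : ℕ → E} (hx : ∀ k, x (k + 1) = x k + a k • G (x k) + ξ k)
    (hξ : IsNegligible a T ξ) {y : ℝ → E} (hy : ∀ t, HasDerivAt y (G (y t)) t)
    {φ : ℕ → ℕ} (hφ : Tendsto φ atTop atTop) (hxφ : Tendsto (x ∘ φ) atTop (𝓝 (y 0)))
    {s : ℝ} (hs : s ∈ Set.Icc 0 T) :
    ∃ κ : ℕ → ℕ, (∀ j, φ j ≤ κ j) ∧ (∀ j, ∑ i ∈ Finset.Ico (φ j) (κ j), a i ≤ s) ∧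
      (∀ j, s < ∑ i ∈ Finset.Ico (φ j) (κ j + 1), a i) ∧
      Tendsto (fun j ↦ x (κ j)) atTop (𝓝 (y s)) := by
  choose κ h1 h2 h3 using fun j ↦ exists_sum_Ico_le_lt hsum (φ j) hs.1
  refine ⟨κ, h1, h2, h3, ?_⟩
  have hκ : Tendsto κ atTop atTop := tendsto_atTop_mono h1 hφ
  have hτ : Tendsto (fun j ↦ ∑ i ∈ Finset.Ico (φ j) (κ j), a i) atTop (𝓝 s) := by
    have h4 : Tendsto (fun j ↦ s - a (κ j)) atTop (𝓝 s) := by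
      simpa using (tendsto_const_nhds (x := s)).sub (ha0.comp hκ)
    refine tendsto_of_tendsto_of_tendsto_of_le_of_le h4 tendsto_const_nhds (fun j ↦ ?_) h2
    have := h3 j
    rw [Finset.sum_Ico_succ_top (h1 j)] at this
    simp only; linarith
  have hyτ := ((lipschitzWith_solution hB hy).continuous.tendsto s).comp hτ
  have hdiff : Tendsto (fun j ↦ x (κ j) - y (∑ i ∈ Finset.Ico (φ j) (κ j), a i)) atTop (𝓝 0) := by
    rw [NormedAddGroup.tendsto_nhds_zero]
    intro ε hε
    filter_upwards [eventually_norm_sub_solution_le hL hB ha ha0 (hs.1.trans hs.2) hx hξ hy hφ hxφ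
      (half_pos hε)] with j hj
    exact (hj _ (h1 j) ((h2 j).trans hs.2)).trans_lt (half_lt_self hε)
  simpa using hdiff.add hyτ

open scoped NNReal in
/-- The limit set of a perturbed Euler scheme is forward invariant. -/
theorem mapClusterPt_solution {G : E → E} {L B : ℝ≥0} (hL : LipschitzWith L G)
    (hB : ∀ u, ‖G u‖ ≤ B) {a : ℕ → ℝ} (ha : ∀ n, 0 < a n) (ha0 : Tendsto a atTop (𝓝 0))
    (hsum : Tendsto (fun n => ∑ i ∈ Finset.range n, a i) atTop atTop)
    {T : ℝ} (hT : 0 < T) {x ξ : ℕ → E} (hx : ∀ k, x (k + 1) = x k + a k • G (x k) + ξ k)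
    (hξ : IsNegligible a T ξ) {y : ℝ → E} (hy : ∀ t, HasDerivAt y (G (y t)) t)
    (hy0 : MapClusterPt (y 0) atTop x) {s : ℝ} (hs : 0 ≤ s) : MapClusterPt (y s) atTop x := by
  have short : ∀ z : ℝ → E, (∀ t, HasDerivAt z (G (z t)) t) → MapClusterPt (z 0) atTop x →
      ∀ s ∈ Set.Icc 0 T, MapClusterPt (z s) atTop x := by
    intro z hz hz0 s hs
    obtain ⟨φ, hφ, hxφ⟩ := hz0.tendsto_subseq
    obtain ⟨κ, h1, -, -, h4⟩ := exists_index_tendsto_solution hL hB ha ha0 hsum hx hξ hz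
      hφ.tendsto_atTop hxφ hs
    exact MapClusterPt.of_comp (tendsto_atTop_mono h1 hφ.tendsto_atTop) h4.mapClusterPt
  -- Shadowing only covers time `T`; since `z T` is again a cluster point, the argument restarts
  -- there.
  have long : ∀ n : ℕ, ∀ z : ℝ → E, (∀ t, HasDerivAt z (G (z t)) t) →
      MapClusterPt (z 0) atTop x → ∀ s ∈ Set.Icc 0 (n * T), MapClusterPt (z s) atTop x := by
    intro n
    induction n with
    | zero => intro z hz hz0 s hs; exact short z hz hz0 s ⟨hs.1, (hs.2.trans (by simp)).trans hT.le⟩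
    | succ n ih =>
      intro z hz hz0 s hs
      rcases le_total s T with h | h
      · exact short z hz hz0 s ⟨hs.1, h⟩
      · have := ih (fun t ↦ z (t + T)) (fun t ↦ (hz (t + T)).comp_add_const t T)
          (by simpa using short z hz hz0 T ⟨hT.le, le_rfl⟩) (s - T)
          ⟨by linarith, by have := hs.2; push_cast at this; linarith⟩
        simpa using this
  obtain ⟨n, hn⟩ := exists_nat_ge (s / T)
  exact long n y hy hy0 s ⟨hs, (div_le_iff₀ hT).1 hn⟩

end Shadowing

/-! ### Upcrossings and the Lyapunov argument. -/

/-- A real sequence that is frequently below `c₁` and frequently above `c₂` has arbitrarily late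
upcrossings of `[c₁, c₂]`. -/
theorem exists_upcrossing {u : ℕ → ℝ} {c₁ c₂ : ℝ} (h₁ : ∃ᶠ n in atTop, u n < c₁)
    (h₂ : ∃ᶠ n in atTop, c₂ < u n) (N : ℕ) :
    ∃ m n, N ≤ m ∧ m ≤ n ∧ u m ≤ c₁ ∧ c₂ < u n ∧ ∀ k, m < k → k ≤ n → c₁ < u k := by
  classical
  obtain ⟨m₀, hm₀, hu₀⟩ := frequently_atTop.1 h₁ N
  obtain ⟨n, hn, hun⟩ := frequently_atTop.1 h₂ m₀
  refine ⟨Nat.findGreatest (fun k ↦ u k ≤ c₁) n, n, hm₀.trans (Nat.le_findGreatest hn hu₀.le),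
    Nat.findGreatest_le n, Nat.findGreatest_spec (P := fun k ↦ u k ≤ c₁) hn hu₀.le, hun,
    fun k hk hkn ↦ not_le.1 (Nat.findGreatest_is_greatest hk hkn)⟩

open scoped NNReal in
/-- A bounded perturbed Euler scheme converges to `Λ` if a function `V` with `interior (V '' Λ) = ∅`
is a strict Lyapunov function for `Λ` along the solutions issued from the limit set. -/
theorem tendsto_infEDist_of_lyapunov {E : Type*} [NormedAddCommGroup E] [NormedSpace ℝ E]
    [CompleteSpace E] {G : E → E} {L B : ℝ≥0} (hL : LipschitzWith L G)
    (hB : ∀ u, ‖G u‖ ≤ B) {a : ℕ → ℝ} (ha : ∀ n, 0 < a n) (ha0 : Tendsto a atTop (𝓝 0))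
    (hsum : Tendsto (fun n => ∑ i ∈ Finset.range n, a i) atTop atTop)
    {T : ℝ} (hT : 0 < T) {x ξ : ℕ → E} (hx : ∀ k, x (k + 1) = x k + a k • G (x k) + ξ k)
    (hξ : IsNegligible a T ξ) {K : Set E} (hK : IsCompact K) (hxK : ∀ k, x k ∈ K)
    {Λ : Set E} {V : E → ℝ} (hV : Continuous V) (hΛ : interior (V '' Λ) = ∅)
    (hle : ∀ y : ℝ → E, (∀ t, HasDerivAt y (G (y t)) t) → MapClusterPt (y 0) atTop x →
      ∀ t, 0 < t → V (y t) ≤ V (y 0))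
    (hlt : ∀ y : ℝ → E, (∀ t, HasDerivAt y (G (y t)) t) → MapClusterPt (y 0) atTop x →
      y 0 ∉ Λ → ∀ t, 0 < t → V (y t) < V (y 0)) :
    Tendsto (fun n => Metric.infEDist (x n) Λ) atTop (𝓝 0) := by
  have hcluster : ∀ q, MapClusterPt q atTop x → q ∈ Λ := by
    by_contra! hne
    obtain ⟨p, hp, hpΛ⟩ := hne
    obtain ⟨z, hz0, hz⟩ := exists_global_solution hL hB p
    subst hz0
    have hzT := mapClusterPt_solution hL hB ha ha0 hsum hT hx hξ hz hp hT.le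
    have hlt1 := hlt z hz hp hpΛ T hT
    obtain ⟨c₁, hc₁, hc₁Λ⟩ : ∃ c ∈ Set.Ioo (V (z T)) (V (z 0)), c ∉ V '' Λ := by
      by_contra! hsub
      have h1 : Set.Ioo (V (z T)) (V (z 0)) ⊆ interior (V '' Λ) := isOpen_Ioo.subset_interior_iff.2 hsub
      rw [hΛ] at h1
      exact (Set.nonempty_Ioo.2 hlt1).ne_empty (Set.subset_empty_iff.1 h1)
    obtain ⟨c₂, hc₁₂, hc₂⟩ := exists_between hc₁.2
    have hf1 : ∃ᶠ n in atTop, V (x n) < c₁ :=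
      hzT.frequently (hV.continuousAt.eventually (gt_mem_nhds hc₁.1))
    have hf2 : ∃ᶠ n in atTop, c₂ < V (x n) :=
      hp.frequently (hV.continuousAt.eventually (lt_mem_nhds hc₂))
    -- `m j` is the last time at or below `c₁` before the level `c₂` is exceeded at `n j`.
    choose m n hNm hmn hm hn hmid using exists_upcrossing hf1 hf2
    obtain ⟨q, -, ψ, hψ, hq⟩ := hK.tendsto_subseq (fun j ↦ hxK (m j))
    have hφ : Tendsto (m ∘ ψ) atTop atTop := (tendsto_atTop_mono hNm tendsto_id).comp hψ.tendsto_atTop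
    obtain ⟨y, hy0, hy⟩ := exists_global_solution hL hB q
    subst hy0
    have hqc : MapClusterPt (y 0) atTop x := MapClusterPt.of_comp hφ hq.mapClusterPt
    have hmem : ∀ s, 0 ≤ s → y s ∈ K := fun s hs ↦ by
      have := mapClusterPt_solution hL hB ha ha0 hsum hT hx hξ hy hqc hs
      exact hK.isClosed.mem_of_mapClusterPt this (Eventually.of_forall hxK)
    have hVq : V (y 0) ≤ c₁ :=
      le_of_tendsto ((hV.tendsto _).comp hq) (Eventually.of_forall fun j ↦ hm (ψ j))
    obtain ⟨ε, hε, hεV⟩ := Metric.uniformContinuousOn_iff_le.1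
      (hK.uniformContinuousOn_of_continuous hV.continuousOn) ((c₂ - c₁) / 2) (by linarith)
    have hshadow := eventually_norm_sub_solution_le hL hB ha ha0 hT.le hx hξ hy hφ hq hε
    -- The limiting solution never exceeds `c₁`, so climbing past `c₂` takes `a`-time more than `T`.
    have hlow : ∀ᶠ j in atTop, ∀ k ≥ m (ψ j), ∑ i ∈ Finset.Ico (m (ψ j)) k, a i ≤ T →
        V (x k) < c₂ := by
      filter_upwards [hshadow] with j hj k hk hkT
      have hs : 0 ≤ ∑ i ∈ Finset.Ico (m (ψ j)) k, a i := Finset.sum_nonneg fun i _ ↦ (ha i).le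
      have h1 := hεV _ (hxK k) _ (hmem _ hs) (by rw [dist_eq_norm]; exact hj k hk hkT)
      have h2 : V (y (∑ i ∈ Finset.Ico (m (ψ j)) k, a i)) ≤ c₁ := by
        rcases hs.eq_or_lt with h | h
        · rw [← h]; exact hVq
        · exact (hle y hy hqc _ h).trans hVq
      rw [Real.dist_eq] at h1
      linarith [le_abs_self (V (x k) - V (y (∑ i ∈ Finset.Ico (m (ψ j)) k, a i)))]
    obtain ⟨κ, h1, h2, h3, h4⟩ := exists_index_tendsto_solution hL hB ha ha0 hsum hx hξ hy hφ hq
      (Set.right_mem_Icc.2 hT.le)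
    have hVT : c₁ ≤ V (y T) := by
      refine ge_of_tendsto ((hV.tendsto _).comp h4) ?_
      filter_upwards [hlow, hφ.eventually (ha0.eventually (gt_mem_nhds hT))] with j hj haj
      -- The index at time `T` lies strictly after `m`, since one step is shorter than `T`, and not
      -- beyond `n`, since `c₂` is not exceeded before then; so `V` is above `c₁` there.
      refine (hmid (ψ j) _ ?_ ?_).le
      · refine (h1 j).lt_of_ne fun h ↦ ?_
        have := h3 j
        rw [← h] at this
        simp at this
        exact absurd haj (not_lt.2 this.le)
      · by_contra! hlt'
        refine absurd (hn (ψ j)) (not_lt.2 (hj _ (hmn _) (le_trans ?_ (h2 j))).le)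
        exact Finset.sum_le_sum_of_subset_of_nonneg (Finset.Ico_subset_Ico_right hlt'.le)
          fun _ _ _ ↦ (ha _).le
    -- Now `c₁ ≤ V (y T) ≤ V (y 0) ≤ c₁`: inside `Λ` this contradicts the choice of `c₁`, outside it
    -- the strict decrease.
    by_cases hqΛ : y 0 ∈ Λ
    · refine hc₁Λ ⟨y 0, hqΛ, le_antisymm hVq (hVT.trans (hle y hy hqc T hT))⟩
    · exact absurd (hlt y hy hqc hqΛ T hT) (not_lt.2 (hVq.trans hVT))
  rw [ENNReal.tendsto_nhds_zero]
  intro ε hε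
  by_contra hcon
  obtain ⟨φ, hφ, hφε⟩ := extraction_of_frequently_atTop (not_eventually.1 hcon)
  obtain ⟨q, -, ψ, hψ, hq⟩ := hK.tendsto_subseq (fun j ↦ hxK (φ j))
  have hqc : MapClusterPt q atTop x :=
    MapClusterPt.of_comp (hφ.tendsto_atTop.comp hψ.tendsto_atTop) hq.mapClusterPt
  have h1 : ε ≤ Metric.infEDist q Λ :=
    ge_of_tendsto ((Metric.continuous_infEDist.tendsto q).comp hq)
      (Eventually.of_forall fun j ↦ (not_le.1 (hφε (ψ j))).le)
  rw [Metric.infEDist_zero_of_mem (hcluster q hqc)] at h1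
  exact absurd h1 (not_le.2 hε)

/-! ### Negligible perturbations and approach to the constraint set. -/

section Negligible

variable {E : Type*} [NormedAddCommGroup E] {a : ℕ → ℝ} {T : ℝ}

theorem IsNegligible.add {ξ η : ℕ → E} (hξ : IsNegligible a T ξ) (hη : IsNegligible a T η) :
    IsNegligible a T (fun n ↦ ξ n + η n) := by
  intro ε hε
  obtain ⟨N₁, h₁⟩ := hξ (ε / 2) (half_pos hε)
  obtain ⟨N₂, h₂⟩ := hη (ε / 2) (half_pos hε)
  refine ⟨max N₁ N₂, fun n hn k hk hkT ↦ ?_⟩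
  rw [Finset.sum_add_distrib]
  have := h₁ n ((le_max_left _ _).trans hn) k hk hkT
  have := h₂ n ((le_max_right _ _).trans hn) k hk hkT
  exact (norm_add_le _ _).trans (by linarith)

theorem isNegligible_of_tendsto_sum {ξ : ℕ → E} {c : E}
    (h : Tendsto (fun n ↦ ∑ i ∈ Finset.range n, ξ i) atTop (𝓝 c)) : IsNegligible a T ξ := by
  intro ε hε
  obtain ⟨N, hN⟩ := Metric.cauchySeq_iff.1 h.cauchySeq ε hε
  refine ⟨N, fun n hn k hk _ ↦ ?_⟩
  rw [Finset.sum_Ico_eq_sub _ hk, ← dist_eq_norm]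
  exact (hN k (hn.trans hk) n hn).le

variable [NormedSpace ℝ E]

theorem isNegligible_smul_of_tendsto (ha : ∀ n, 0 < a n) (hT : 0 < T) {e : ℕ → E}
    (he : Tendsto e atTop (𝓝 0)) : IsNegligible a T (fun n ↦ a n • e n) := by
  intro ε hε
  obtain ⟨N, hN⟩ := eventually_atTop.1
    ((NormedAddGroup.tendsto_nhds_zero.1 he) (ε / T) (div_pos hε hT))
  refine ⟨N, fun n hn k _ hkT ↦ (norm_sum_le _ _).trans ?_⟩
  calc ∑ i ∈ Finset.Ico n k, ‖a i • e i‖ ≤ ∑ i ∈ Finset.Ico n k, a i * (ε / T) := by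
        refine Finset.sum_le_sum fun i hi ↦ ?_
        rw [norm_smul, Real.norm_of_nonneg (ha i).le]
        exact mul_le_mul_of_nonneg_left (hN i (hn.trans (Finset.mem_Ico.1 hi).1)).le (ha i).le
    _ = (∑ i ∈ Finset.Ico n k, a i) * (ε / T) := by rw [Finset.sum_mul]
    _ ≤ T * (ε / T) := by gcongr
    _ = ε := mul_div_cancel₀ _ hT.ne'

theorem le_windowEnd (ha : ∀ n, 0 < a n)
    (hsum : Tendsto (fun n => ∑ i ∈ Finset.range n, a i) atTop atTop) (hT : 0 < T) {n k : ℕ}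
    (h : ∑ i ∈ Finset.Ico n k, a i < T) : k ≤ windowEnd a T n := by
  have hne : {k | n ≤ k ∧ T ≤ ∑ j ∈ Finset.Icc n k, a j}.Nonempty := by
    obtain ⟨k, hk, -, hk'⟩ := exists_sum_Ico_le_lt hsum n hT.le
    exact ⟨k, hk, by rw [← Finset.Ico_add_one_right_eq_Icc]; exact hk'.le⟩
  obtain ⟨-, h2⟩ := Nat.sInf_mem hne
  by_contra! hlt
  refine absurd h (not_lt.2 (h2.trans ?_))
  rw [← Finset.Ico_add_one_right_eq_Icc]
  exact Finset.sum_le_sum_of_subset_of_nonneg (Finset.Ico_subset_Ico_right hlt)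
    fun _ _ _ ↦ (ha _).le

/-- The strict inequality `T < T'` places every window of length at most `T` inside the one ending
at `windowEnd a T' n`; nonnegativity of `c` then gives the bound. -/
theorem sum_Ico_le_of_windowEnd (ha : ∀ n, 0 < a n)
    (hsum : Tendsto (fun n => ∑ i ∈ Finset.range n, a i) atTop atTop) {T' : ℝ} (hT' : 0 < T')
    (hTT' : T < T') {c : ℕ → ℝ} (hc : ∀ n, 0 ≤ c n)
    (hwin : Tendsto (fun n ↦ ∑ j ∈ Finset.Icc n (windowEnd a T' n), c j) atTop (𝓝 0)) :
    ∀ ε > 0, ∃ N, ∀ n ≥ N, ∀ k ≥ n, ∑ i ∈ Finset.Ico n k, a i ≤ T →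
      ∑ i ∈ Finset.Ico n k, c i ≤ ε := by
  intro ε hε
  obtain ⟨N, hN⟩ := eventually_atTop.1 (hwin.eventually (gt_mem_nhds hε))
  refine ⟨N, fun n hn k hk hkT ↦ le_trans ?_ (hN n hn).le⟩
  refine Finset.sum_le_sum_of_subset_of_nonneg (fun i hi ↦ ?_) fun _ _ _ ↦ hc _
  have := le_windowEnd ha hsum hT' (hkT.trans_lt hTT')
  rw [Finset.mem_Ico] at hi
  exact Finset.mem_Icc.2 ⟨hi.1, hi.2.le.trans this⟩

/-- If the steps outside a neighbourhood of `S`, measured by the gap function `g`, are negligible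
over windows, then a bounded scheme approaches `S`. -/
theorem tendsto_infDist_of_window (ha : ∀ n, 0 < a n) (ha0 : Tendsto a atTop (𝓝 0))
    (hsum : Tendsto (fun n => ∑ i ∈ Finset.range n, a i) atTop atTop) (hT : 0 < T)
    {x h ξ : ℕ → E} (hx : ∀ k, x (k + 1) = x k + a k • h k + ξ k) (hξ : IsNegligible a T ξ)
    {B : ℝ} (hB : ∀ k, ‖h k‖ ≤ B) {K : Set E} (hK : IsCompact K) (hxK : ∀ k, x k ∈ K)
    {S : Set E} {g : E → ℝ} (hg : Continuous g) (hg0 : ∀ u, 0 ≤ g u) (hgS : ∀ u, g u = 0 → u ∈ S)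
    {γ : ℕ → ℝ} (haγ : ∀ᶠ n in atTop, a n ≤ γ n)
    (hwin : ∀ ε > 0, ∃ N, ∀ n ≥ N, ∀ k ≥ n, ∑ i ∈ Finset.Ico n k, a i ≤ T →
      ∑ i ∈ Finset.Ico n k, γ i * g (x i) ≤ ε) :
    Tendsto (fun n ↦ Metric.infDist (x n) S) atTop (𝓝 0) := by
  rw [NormedAddGroup.tendsto_nhds_zero]
  intro ε hε
  have hB0 : 0 ≤ B := (norm_nonneg _).trans (hB 0)
  -- Short enough that the drift over `a`-time `τ` is at most `ε / 3`.
  set τ := min T (ε / (3 * (B + 1))) with hτ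
  have hτ0 : 0 < τ := lt_min hT (by positivity)
  have hτT : τ ≤ T := min_le_left _ _
  have hBτ : B * τ ≤ ε / 3 := by
    calc B * τ ≤ (B + 1) * (ε / (3 * (B + 1))) := by
          gcongr
          · linarith
          · exact min_le_right _ _
      _ = ε / 3 := by field_simp
  -- By compactness, `g` has a positive lower bound `η` on the part of `K` at distance at least `ε /
  -- 3` from `S`.
  obtain ⟨η, hη, hgη⟩ := (hK.inter_right (isClosed_le (continuous_const (y := ε / 3))
      (Metric.continuous_infDist_pt S))).exists_forall_le' (a := 0) (hg.continuousOn) (by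
    rintro u ⟨-, hu⟩
    refine (hg0 u).lt_of_ne' fun h0 ↦ ?_
    have : ε / 3 ≤ Metric.infDist u S := hu
    rw [Metric.infDist_zero_of_mem (hgS u h0)] at this
    linarith)
  obtain ⟨N₁, hN₁⟩ := eventually_atTop.1 (haγ.and (ha0.eventually (gt_mem_nhds (half_pos hτ0))))
  obtain ⟨N₂, hN₂⟩ := hwin (η * τ / 4) (by positivity)
  obtain ⟨N₃, hN₃⟩ := hξ (ε / 6) (by positivity)
  refine eventually_atTop.2 ⟨max N₁ (max N₂ N₃), fun n hn ↦ ?_⟩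
  have hn₁ : N₁ ≤ n := (le_max_left _ _).trans hn
  have hn₂ : N₂ ≤ n := ((le_max_left _ _).trans (le_max_right _ _)).trans hn
  have hn₃ : N₃ ≤ n := ((le_max_right _ _).trans (le_max_right _ _)).trans hn
  obtain ⟨k, hk, hk1, hk2⟩ := exists_sum_Ico_le_lt hsum n hτ0.le
  rw [Finset.sum_Ico_succ_top hk] at hk2
  have hak := (hN₁ k (hn₁.trans hk)).2
  -- Otherwise the window sum would be at least `η` times an `a`-length exceeding `τ / 2`, against
  -- the bound `η * τ / 4`.
  obtain ⟨i, hi, hgi⟩ : ∃ i ∈ Finset.Ico n k, g (x i) < η := by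
    by_contra! hcon
    have h1 := hN₂ n hn₂ k hk (hk1.trans hτT)
    have h2 : (∑ i ∈ Finset.Ico n k, a i) * η ≤ ∑ i ∈ Finset.Ico n k, γ i * g (x i) := by
      rw [Finset.sum_mul]
      refine Finset.sum_le_sum fun i hi ↦ ?_
      have h3 := (hN₁ i (hn₁.trans (Finset.mem_Ico.1 hi).1)).1
      exact mul_le_mul h3 (hcon i hi) hη.le ((ha i).le.trans h3)
    nlinarith
  obtain ⟨hni, hik⟩ := Finset.mem_Ico.1 hi
  have hiS : Metric.infDist (x i) S < ε / 3 := by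
    by_contra! hcon
    exact absurd (hgη (x i) ⟨hxK i, hcon⟩) (not_le.2 hgi)
  have hiτ : ∑ j ∈ Finset.Ico n i, a j ≤ τ :=
    (Finset.sum_le_sum_of_subset_of_nonneg (Finset.Ico_subset_Ico_right hik.le)
      fun _ _ _ ↦ (ha _).le).trans hk1
  have hdiff : x i - x n = ∑ j ∈ Finset.Ico n i, a j • h j + ∑ j ∈ Finset.Ico n i, ξ j := by
    rw [← Finset.sum_add_distrib, ← Finset.sum_Ico_sub _ hni]
    refine Finset.sum_congr rfl fun j _ ↦ ?_
    rw [hx]; abel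
  have hdrift : ‖∑ j ∈ Finset.Ico n i, a j • h j‖ ≤ B * τ := by
    refine (norm_sum_le _ _).trans ?_
    calc _ ≤ ∑ j ∈ Finset.Ico n i, a j * B := by
          refine Finset.sum_le_sum fun j _ ↦ ?_
          rw [norm_smul, Real.norm_of_nonneg (ha j).le]
          exact mul_le_mul_of_nonneg_left (hB j) (ha j).le
      _ ≤ B * τ := by rw [← Finset.sum_mul, mul_comm]; gcongr
  have hnoise := hN₃ n hn₃ i hni (hiτ.trans hτT)
  have hd : dist (x n) (x i) ≤ B * τ + ε / 6 := by
    rw [dist_comm, dist_eq_norm, hdiff]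
    exact (norm_add_le _ _).trans (add_le_add hdrift hnoise)
  rw [Real.norm_of_nonneg Metric.infDist_nonneg]
  linarith [Metric.infDist_le_infDist_add_dist (s := S) (x := x n) (y := x i)]

end Negligible

/-! ### Almost sure convergence of the weighted noise. -/

section Martingale

variable {Ω : Type*} {m0 : MeasurableSpace Ω} {μ : Measure Ω} [IsProbabilityMeasure μ]
  {ℱ : Filtration ℕ m0}

/-- A series of square integrable martingale differences converges almost surely if the sum of the
variances is finite. -/
theorem ae_exists_tendsto_sum_of_sum_sq_le {D : ℕ → Ω → ℝ}
    (hD : ∀ n, StronglyMeasurable[ℱ (n + 1)] (D n)) (hD2 : ∀ n, MemLp (D n) 2 μ)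
    (hD0 : ∀ n, μ[D n | ℱ n] =ᵐ[μ] 0) {C : ℝ}
    (hC : ∀ n, ∑ k ∈ Finset.range n, ∫ ω, D k ω ^ 2 ∂μ ≤ C) :
    ∀ᵐ ω ∂μ, ∃ c, Tendsto (fun n ↦ ∑ k ∈ Finset.range n, D k ω) atTop (𝓝 c) := by
  set N : ℕ → Ω → ℝ := fun n ω ↦ ∑ k ∈ Finset.range n, D k ω with hN
  have hNs : ∀ n, N (n + 1) = N n + D n := fun n ↦ by
    ext ω; simp [hN, Finset.sum_range_succ]
  have hadp : StronglyAdapted ℱ N := fun n ↦ Finset.stronglyMeasurable_fun_sum _ fun k hk ↦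
    (hD k).mono (ℱ.mono (Finset.mem_range.1 hk))
  have hN2 : ∀ n, MemLp (N n) 2 μ := fun n ↦ memLp_finsetSum _ fun k _ ↦ hD2 k
  have hmart : Martingale N ℱ μ := by
    refine martingale_of_condExp_sub_eq_zero_nat hadp
      (fun n ↦ (hN2 n).integrable one_le_two) fun n ↦ ?_
    rw [hNs, add_sub_cancel_left]; exact hD0 n
  -- Orthogonality of increments: the second moment of the partial sum is the sum of the variances,
  -- which bounds it in `L¹` for Doob's theorem.
  have hcross : ∀ n, ∫ ω, N n ω * D n ω ∂μ = 0 := by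
    intro n
    have hint : Integrable (N n * D n) μ := (hN2 n).integrable_mul (hD2 n)
    have h1 := condExp_mul_of_stronglyMeasurable_left (hadp n) hint
      ((hD2 n).integrable one_le_two)
    have h2 : μ[N n * D n | ℱ n] =ᵐ[μ] 0 := by
      filter_upwards [h1, hD0 n] with ω h3 h4
      rw [h3, Pi.mul_apply, h4]; simp
    have h3 := integral_condExp (μ := μ) (f := N n * D n) (ℱ.le n)
    rw [integral_congr_ae h2] at h3
    simpa using h3.symm
  have hsq : ∀ n, ∫ ω, N n ω ^ 2 ∂μ = ∑ k ∈ Finset.range n, ∫ ω, D k ω ^ 2 ∂μ := by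
    intro n
    induction n with
    | zero => simp [hN]
    | succ n ih =>
      have hint : Integrable (fun ω ↦ N n ω * D n ω) μ := (hN2 n).integrable_mul (hD2 n)
      have he : ∀ ω, N (n + 1) ω ^ 2 = N n ω ^ 2 + 2 * (N n ω * D n ω) + D n ω ^ 2 := fun ω ↦ by
        rw [hNs, Pi.add_apply]; ring
      simp_rw [he]
      have hint' : Integrable (fun ω ↦ N n ω ^ 2 + 2 * (N n ω * D n ω)) μ :=
        (hN2 n).integrable_sq.add (hint.const_mul 2)
      rw [integral_add hint' (hD2 n).integrable_sq,
        integral_add (hN2 n).integrable_sq (hint.const_mul 2), integral_const_mul, hcross, ih,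
        Finset.sum_range_succ]
      ring
  refine hmart.submartingale.exists_ae_tendsto_of_bdd (R := (1 + C).toNNReal) fun n ↦ ?_
  have hNi := (hN2 n).integrable one_le_two
  rw [eLpNorm_one_eq_lintegral_enorm, ← ofReal_integral_norm_eq_lintegral_enorm hNi]
  refine ENNReal.ofReal_le_ofReal ?_
  calc ∫ ω, ‖N n ω‖ ∂μ ≤ ∫ ω, (1 + N n ω ^ 2) ∂μ := by
        refine integral_mono hNi.norm ((integrable_const 1).add (hN2 n).integrable_sq) fun ω ↦ ?_
        simp only [Real.norm_eq_abs]
        nlinarith [sq_abs (N n ω), sq_nonneg (|N n ω| - 1)]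
    _ = 1 + ∫ ω, N n ω ^ 2 ∂μ := by
        rw [integral_add (integrable_const 1) (hN2 n).integrable_sq]; simp
    _ ≤ 1 + C := by rw [hsq]; gcongr; exact hC n

/-- A martingale transform with square summable weights converges almost surely if the conditional
variances are almost surely bounded. -/
theorem ae_exists_tendsto_sum_mul_of_condExp_sq_le {D v : ℕ → Ω → ℝ}
    (hD : ∀ n, StronglyMeasurable[ℱ (n + 1)] (D n)) (hD2 : ∀ n, MemLp (D n) 2 μ)
    (hD0 : ∀ n, μ[D n | ℱ n] =ᵐ[μ] 0) (hv : ∀ n, StronglyMeasurable[ℱ n] (v n))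
    (hDv : ∀ n, μ[fun ω ↦ D n ω ^ 2 | ℱ n] ≤ᵐ[μ] v n)
    (hbdd : ∀ᵐ ω ∂μ, BddAbove (Set.range fun n ↦ v n ω)) {a : ℕ → ℝ}
    (ha : Summable fun n ↦ a n ^ 2) :
    ∀ᵐ ω ∂μ, ∃ c, Tendsto (fun n ↦ ∑ k ∈ Finset.range n, a k * D k ω) atTop (𝓝 c) := by
  -- Truncation to `{v k ≤ C}`, which is known at time `k`, keeps the martingale difference property
  -- and bounds the variances. At almost every sample point some integer `C` makes the truncation
  -- void.
  have hlevel : ∀ C : ℕ, ∀ᵐ ω ∂μ, ∃ c, Tendsto (fun n ↦ ∑ k ∈ Finset.range n,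
      a k * {ω | v k ω ≤ C}.indicator (D k) ω) atTop (𝓝 c) := by
    intro C
    have hmeas : ∀ n, MeasurableSet[ℱ n] {ω | v n ω ≤ C} := fun n ↦
      (hv n).measurable measurableSet_Iic
    have hmeas' : ∀ n, MeasurableSet {ω | v n ω ≤ C} := fun n ↦ ℱ.le n _ (hmeas n)
    refine ae_exists_tendsto_sum_of_sum_sq_le (ℱ := ℱ) (C := (∑' n, a n ^ 2) * C)
      (fun n ↦ ?_) (fun n ↦ ?_) (fun n ↦ ?_) (fun n ↦ ?_)
    · exact ((hD n).indicator (ℱ.mono n.le_succ _ (hmeas n))).const_mul (a n)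
    · exact ((hD2 n).indicator (hmeas' n)).const_mul (a n)
    · have h1 := condExp_indicator ((hD2 n).integrable one_le_two) (hmeas n)
      have h2 := condExp_smul (μ := μ) (a n) ({ω | v n ω ≤ C}.indicator (D n)) (ℱ n)
      refine h2.trans ?_
      filter_upwards [h1, hD0 n] with ω h3 h4
      rw [Pi.smul_apply, h3, Set.indicator_apply, h4]; simp
    · have hterm : ∀ k, ∫ ω, (a k * {ω | v k ω ≤ C}.indicator (D k) ω) ^ 2 ∂μ ≤ a k ^ 2 * C := by
        intro k
        have he : ∀ ω, (a k * {ω | v k ω ≤ C}.indicator (D k) ω) ^ 2 =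
            a k ^ 2 * {ω | v k ω ≤ C}.indicator (fun ω ↦ D k ω ^ 2) ω := fun ω ↦ by
          by_cases h : ω ∈ {ω | v k ω ≤ C}
          · simp only [Set.indicator_of_mem h]; ring
          · simp only [Set.indicator_of_notMem h]; ring
        simp_rw [he]
        rw [integral_const_mul, integral_indicator (hmeas' k),
          ← setIntegral_condExp (ℱ.le k) (hD2 k).integrable_sq (hmeas k)]
        refine mul_le_mul_of_nonneg_left ?_ (sq_nonneg _)
        calc ∫ ω in {ω | v k ω ≤ C}, (μ[fun ω ↦ D k ω ^ 2 | ℱ k]) ω ∂μ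
            ≤ ∫ ω in {ω | v k ω ≤ C}, (C : ℝ) ∂μ := by
              refine setIntegral_mono_ae_restrict integrable_condExp.integrableOn
                (integrable_const _).integrableOn ?_
              filter_upwards [ae_restrict_of_ae (hDv k), ae_restrict_mem (hmeas' k)] with ω h1 h2
              exact h1.trans h2
          _ ≤ C := by
              rw [setIntegral_const, smul_eq_mul]
              exact mul_le_of_le_one_left C.cast_nonneg measureReal_le_one
      calc _ ≤ ∑ k ∈ Finset.range n, a k ^ 2 * C := Finset.sum_le_sum fun k _ ↦ hterm k
        _ ≤ _ := by
          rw [← Finset.sum_mul]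
          gcongr
          exact ha.sum_le_tsum _ fun _ _ ↦ sq_nonneg _
  filter_upwards [ae_all_iff.2 hlevel, hbdd] with ω h1 ⟨b, hb⟩
  obtain ⟨C, hC⟩ := exists_nat_ge b
  obtain ⟨c, hc⟩ := h1 C
  refine ⟨c, hc.congr fun n ↦ Finset.sum_congr rfl fun k _ ↦ ?_⟩
  rw [Set.indicator_of_mem (show ω ∈ {ω | v k ω ≤ C} from (hb ⟨k, rfl⟩).trans hC)]

end Martingale

/-- The natural filtration of the noise. -/
def noiseFiltration {Ω : Type*} [m0 : MeasurableSpace Ω] {d : ℕ}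
    {x₀ : Ω → EuclideanSpace ℝ (Fin d)} {M : ℕ → Ω → EuclideanSpace ℝ (Fin d)}
    (hx₀ : Measurable x₀) (hM : ∀ n, Measurable (M (n + 1))) : Filtration ℕ m0 where
  seq := noiseSigma x₀ M
  mono' _ _ hij := sup_le_sup_left
    (biSup_mono fun _ hm ↦ Finset.Icc_subset_Icc_right hij hm) _
  le' n := sup_le hx₀.comap_le <| iSup₂_le fun m hm ↦ by
    obtain ⟨k, rfl⟩ : ∃ k, m = k + 1 := ⟨m - 1, by have := (Finset.mem_Icc.1 hm).1; omega⟩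
    exact (hM k).comap_le

theorem IsMartingaleNoise.ae_exists_tendsto_sum {Ω : Type*} [MeasurableSpace Ω] {d : ℕ}
    {μ : Measure Ω} [IsProbabilityMeasure μ] {x₀ : Ω → EuclideanSpace ℝ (Fin d)}
    {M : ℕ → Ω → EuclideanSpace ℝ (Fin d)} (hM : IsMartingaleNoise μ x₀ M) {a : ℕ → ℝ}
    (ha : Summable fun n ↦ a n ^ 2) :
    ∀ᵐ ω ∂μ, ∃ c, Tendsto (fun n ↦ ∑ k ∈ Finset.range n, a k • M (k + 1) ω) atTop (𝓝 c) := by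
  set ℱ := noiseFiltration hM.measurable_init hM.measurable_noise
  have hMn : ∀ n, Measurable[ℱ (n + 1)] (M (n + 1)) := fun n ↦ by
    refine measurable_iff_comap_le.2 (le_sup_of_le_right ?_)
    exact le_iSup₂_of_le (n + 1) (Finset.mem_Icc.2 ⟨by omega, le_rfl⟩) le_rfl
  have hcoord : ∀ i : Fin d, ∀ᵐ ω ∂μ, ∃ c,
      Tendsto (fun n ↦ ∑ k ∈ Finset.range n, a k * M (k + 1) ω i) atTop (𝓝 c) := by
    intro i
    set p : EuclideanSpace ℝ (Fin d) →L[ℝ] ℝ := EuclideanSpace.proj i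
    have hint2 : ∀ n, MemLp (fun ω ↦ M (n + 1) ω i) 2 μ := fun n ↦ p.comp_memLp' (hM.memLp_two n)
    -- The conditional second moment of the full norm dominates that of each coordinate.
    refine ae_exists_tendsto_sum_mul_of_condExp_sq_le (ℱ := ℱ)
      (v := fun n ↦ μ[fun ω' => ‖M (n + 1) ω'‖ ^ 2 | noiseSigma x₀ M n])
      (fun n ↦ ?_) hint2 (fun n ↦ ?_) (fun n ↦ stronglyMeasurable_condExp) (fun n ↦ ?_)
      hM.condExp_sq_bdd ha
    · exact (p.continuous.measurable.comp (hMn n)).stronglyMeasurable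
    · have h1 := p.comp_condExp_comm (m := ℱ n) ((hM.memLp_two n).integrable one_le_two)
      refine EventuallyEq.trans (EventuallyEq.symm h1) ?_
      filter_upwards [hM.condExp_eq_zero n] with ω hω
      have : (μ[M (n + 1) | ℱ n]) ω = 0 := hω
      simp [this]
    · refine condExp_mono (hint2 n).integrable_sq (hM.memLp_two n).norm.integrable_sq
        (Eventually.of_forall fun ω ↦ ?_)
      have := PiLp.norm_apply_le (M (n + 1) ω) i
      rw [Real.norm_eq_abs] at this
      simp only
      rw [← sq_abs]
      gcongr
  filter_upwards [ae_all_iff.2 hcoord] with ω hω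
  choose c hc using hω
  refine ⟨WithLp.toLp 2 c, ?_⟩
  have h1 : Tendsto (fun n i ↦ ∑ k ∈ Finset.range n, a k * M (k + 1) ω i) atTop (𝓝 c) :=
    tendsto_pi_nhds.2 hc
  have h2 := ((PiLp.continuous_toLp 2 (fun _ : Fin d ↦ ℝ)).tendsto c).comp h1
  refine h2.congr fun n ↦ ?_
  ext i
  simp

/-! ### The limit projection and solutions of the projected inclusion. -/

section ApproxProjection

variable {d : ℕ} {S : Set (EuclideanSpace ℝ (Fin d))}
  {f P : EuclideanSpace ℝ (Fin d) → EuclideanSpace ℝ (Fin d)}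

theorem eq_of_mem_projSet_of_mem {y p : EuclideanSpace ℝ (Fin d)} (hp : p ∈ projSet S y)
    (hy : y ∈ S) : p = y := by
  have := hp.2 y hy
  rw [sub_self, norm_zero] at this
  exact (sub_eq_zero.1 (norm_le_zero_iff.1 this)).symm

theorem norm_sub_le_infDist_of_mem_projSet {y p : EuclideanSpace ℝ (Fin d)}
    (hp : p ∈ projSet S y) : ‖y - p‖ ≤ Metric.infDist y S :=
  (Metric.le_infDist ⟨p, hp.1⟩).2 fun z hz ↦ by rw [dist_eq_norm]; exact hp.2 z hz

theorem IsApproxProjection.tendsto (hfP : IsApproxProjection S f P)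
    (y : EuclideanSpace ℝ (Fin d)) : Tendsto (fun n ↦ f^[n] y) atTop (𝓝 (P y)) :=
  (hfP.tendsto_iterate {y} isCompact_singleton).tendsto_at (Set.mem_singleton y)

/-- The iterates at a fixed point are constant, so `P y = y`, and `P` takes values in `S`. -/
theorem IsApproxProjection.mem_of_isFixedPt (hfP : IsApproxProjection S f P)
    {y : EuclideanSpace ℝ (Fin d)} (hy : f y = y) : y ∈ S := by
  have h := hfP.tendsto y
  simp_rw [Function.iterate_fixed hy] at h
  rw [tendsto_nhds_unique tendsto_const_nhds h]
  exact (hfP.proj y).1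

theorem IsApproxProjection.lipschitzWith (hfP : IsApproxProjection S f P)
    (hf : ∀ u v, ‖f u - f v‖ ≤ ‖u - v‖) : LipschitzWith 1 P := by
  have hf1 : LipschitzWith 1 f := LipschitzWith.mk_one fun u v ↦ by
    simpa only [dist_eq_norm] using hf u v
  refine LipschitzWith.mk_one fun u v ↦ ?_
  refine le_of_tendsto ((hfP.tendsto u).dist (hfP.tendsto v)) (Eventually.of_forall fun n ↦ ?_)
  simpa using (hf1.iterate n).dist_le_mul u v

end ApproxProjection

theorem IsStepSize.tendsto_zero {a : ℕ → ℝ} (ha : IsStepSize a) : Tendsto a atTop (𝓝 0) := by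
  have h := (Real.continuous_sqrt.tendsto 0).comp ha.sq_summable.tendsto_atTop_zero
  rw [Real.sqrt_zero] at h
  exact h.congr fun n ↦ Real.sqrt_sq (ha.pos n).le

/-- A solution of `y' = H y` that stays in `S` solves the projected inclusion. -/
theorem isInclusionSolution_of_hasDerivAt {d : ℕ} {S : Set (EuclideanSpace ℝ (Fin d))}
    {H : EuclideanSpace ℝ (Fin d) → EuclideanSpace ℝ (Fin d)}
    {y : ℝ → EuclideanSpace ℝ (Fin d)} {B : NNReal} (hy : LipschitzWith B y)
    (hyS : ∀ t, 0 ≤ t → y t ∈ S) (hyH : ∀ t, 0 ≤ t → HasDerivAt y (H (y t)) t) :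
    IsInclusionSolution S H y where
  absolutelyContinuous _ _ := hy.lipschitzOnWith.absolutelyContinuousOnInterval
  mem := hyS
  inclusion := Eventually.of_forall fun t ht ↦
    ⟨0, fun v _ ↦ by simp, by simpa using hyH t ht.le⟩

/-! ### The convergence theorem. -/

theorem theorem3 {Ω : Type*} [MeasurableSpace Ω] (μ : Measure Ω) [IsProbabilityMeasure μ]
    (d : ℕ) (S : Set (EuclideanSpace ℝ (Fin d)))
    (H f P : EuclideanSpace ℝ (Fin d) → EuclideanSpace ℝ (Fin d))
    (a γ : ℕ → ℝ) (x M : ℕ → Ω → EuclideanSpace ℝ (Fin d))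
    (V : EuclideanSpace ℝ (Fin d) → ℝ) (T : ℝ)
    -- the iteration
    (hx : ∀ k ω, x (k + 1) ω =
      (1 - γ k) • x k ω + γ k • f (x k ω) + a k • (H (x k ω) + M (k + 1) ω))
    -- the vector field is Lipschitz
    (hH : ∃ L, LipschitzWith L H)
    -- the step sizes
    (ha : IsStepSize a) (hγ : IsStepSize γ) (haγ : a =o[atTop] γ)
    -- the noise
    (hM : IsMartingaleNoise μ (x 0) M)
    -- the iterates stay in a sample point dependent compact set
    (hcpt : ∀ᵐ ω ∂μ, ∃ K : Set (EuclideanSpace ℝ (Fin d)), IsCompact K ∧ ∀ k, x k ω ∈ K)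
    -- the approximate projection, and the constraint set
    (hfP : IsApproxProjection S f P)
    (hf : ∀ u v, ‖f u - f v‖ ≤ ‖u - v‖)
    (hSb : Bornology.IsBounded S) (hS : IsProximalRetract S)
    -- the Lyapunov function
    (hV : IsLyapunovFunction S H V)
    -- the corrections `γ_j ‖f(x_j) - x_j‖` are negligible over time windows of length `T`
    (hT : 0 < T)
    (hwin : ∀ᵐ ω ∂μ, Tendsto
      (fun n => ∑ j ∈ Finset.Icc n (windowEnd a T n), γ j * ‖f (x j ω) - x j ω‖)
      atTop (𝓝 0)) :
    ∀ᵐ ω ∂μ, Tendsto (fun n => Metric.infEDist (x n ω) (equilibriumSet S H)) atTop (𝓝 0) := by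
  obtain ⟨L, hL⟩ := hH
  have hPlip := hfP.lipschitzWith hf
  have hGlip : LipschitzWith (L * 1) (H ∘ P) := hL.comp hPlip
  obtain ⟨B, hB⟩ : ∃ B : NNReal, ∀ u, ‖(H ∘ P) u‖ ≤ B := by
    obtain ⟨B, hB⟩ := (hL.isBounded_image hSb).exists_norm_le
    exact ⟨B.toNNReal, fun u ↦ (hB _ ⟨P u, (hfP.proj u).1, rfl⟩).trans (Real.le_coe_toNNReal B)⟩
  have hPS : ∀ u ∈ S, P u = u := fun u hu ↦ eq_of_mem_projSet_of_mem (hfP.proj u) hu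
  have hSne : S.Nonempty := ⟨P 0, (hfP.proj 0).1⟩
  have ha0 := ha.tendsto_zero
  have hT2 : 0 < T / 2 := half_pos hT
  have haγ' : ∀ᶠ n in atTop, a n ≤ γ n := by
    filter_upwards [haγ.bound one_pos] with n hn
    simpa [abs_of_pos (ha.pos n), abs_of_pos (hγ.pos n)] using hn
  filter_upwards [hcpt, hwin, hM.ae_exists_tendsto_sum ha.sq_summable] with ω ⟨K, hK, hxK⟩ hwin
    ⟨c, hc⟩
  -- Halving `T` gives the strict inequality needed to fit inside the given windows.
  have hwin' := sum_Ico_le_of_windowEnd ha.pos ha.sum_eq_top hT (half_lt_self hT)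
    (fun n ↦ mul_nonneg (hγ.pos n).le (norm_nonneg _)) hwin
  have hcorr : IsNegligible a (T / 2) (fun k ↦ γ k • (f (x k ω) - x k ω)) := by
    intro ε hε
    obtain ⟨N, hN⟩ := hwin' ε hε
    refine ⟨N, fun n hn k hk hkT ↦ (norm_sum_le _ _).trans ?_⟩
    simpa only [norm_smul, Real.norm_of_nonneg (hγ.pos _).le] using hN n hn k hk hkT
  have hpert := hcorr.add (isNegligible_of_tendsto_sum hc)
  obtain ⟨B', hB'⟩ := (hL.isBounded_image hK.isBounded).exists_norm_le
  have hdist : Tendsto (fun n ↦ Metric.infDist (x n ω) S) atTop (𝓝 0) := by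
    refine tendsto_infDist_of_window ha.pos ha0 ha.sum_eq_top hT2 (x := fun k ↦ x k ω)
      (h := fun k ↦ H (x k ω)) (fun k ↦ ?_) hpert (fun k ↦ hB' _ ⟨_, hxK k, rfl⟩) hK hxK
      (g := fun u ↦ ‖f u - u‖) (hfP.continuous.sub continuous_id).norm (fun _ ↦ norm_nonneg _)
      (fun u hu ↦ hfP.mem_of_isFixedPt (sub_eq_zero.1 (norm_eq_zero.1 hu))) haγ' hwin'
    rw [hx]; module
  -- `‖H x - H (P x)‖` is at most `L` times the distance from `x` to `S`.
  have herr : Tendsto (fun k ↦ H (x k ω) - H (P (x k ω))) atTop (𝓝 0) := by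
    refine squeeze_zero_norm (fun k ↦ (hL.norm_sub_le _ _).trans (mul_le_mul_of_nonneg_left
      (norm_sub_le_infDist_of_mem_projSet (hfP.proj _)) L.2)) ?_
    simpa using hdist.const_mul (L : ℝ)
  have hξ := hpert.add (isNegligible_smul_of_tendsto ha.pos hT2 herr)
  have hrec : ∀ k, x (k + 1) ω = x k ω + a k • (H ∘ P) (x k ω) +
      (γ k • (f (x k ω) - x k ω) + a k • M (k + 1) ω +
        a k • (H (x k ω) - H (P (x k ω)))) := fun k ↦ by
    rw [hx, Function.comp_apply]; module
  have hclS : ∀ q, MapClusterPt q atTop (fun k ↦ x k ω) → q ∈ S := by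
    intro q hq
    obtain ⟨φ, hφ, hxφ⟩ := hq.tendsto_subseq
    have h1 := ((Metric.continuous_infDist_pt S).tendsto q).comp hxφ
    exact (hS.1.mem_iff_infDist_zero hSne).2
      (tendsto_nhds_unique h1 (hdist.comp hφ.tendsto_atTop))
  have hsol : ∀ y : ℝ → EuclideanSpace ℝ (Fin d), (∀ t, HasDerivAt y ((H ∘ P) (y t)) t) →
      MapClusterPt (y 0) atTop (fun k ↦ x k ω) → IsInclusionSolution S H y := by
    intro y hy hy0
    have hyS : ∀ t, 0 ≤ t → y t ∈ S := fun t ht ↦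
      hclS _ (mapClusterPt_solution hGlip hB ha.pos ha0 ha.sum_eq_top hT2 hrec hξ hy hy0 ht)
    refine isInclusionSolution_of_hasDerivAt (lipschitzWith_solution hB hy) hyS fun t ht ↦ ?_
    have := hy t
    rwa [Function.comp_apply, hPS _ (hyS t ht)] at this
  exact tendsto_infEDist_of_lyapunov hGlip hB ha.pos ha0 ha.sum_eq_top hT2 hrec hξ hK hxK
    hV.contDiff.continuous hV.interior_image (fun y hy hy0 ↦ hV.le y (hsol y hy hy0))
    (fun y hy hy0 ↦ hV.lt y (hsol y hy hy0))
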